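/- Let $p$ be an odd prime, let $k$ be a field of characteristic $p$, and let $f\in k[[\zeta]]$ be a power series of the form \[ f(\zeta)=\zeta\Bigl(1+\sum_{j=2}^{\infty}a_j\zeta^j\Bigr),\qquad a_j\in k. \] Let $f^p$ denote the $p$-th iterate of $f$ under composition. Put \[ \alpha_1:=a_2^{p-2}\Bigl(\tfrac32a_2^3+a_3^2-a_2a_4\Bigr),\qquad \beta_1:=\frac{a_3}{a_2}\,\alpha_1,\qquad \gamma_1:=-\Bigl(\frac{3a_2}{2}-\frac{a_4}{a_2}\Bigr)\alpha_1, \] where the last two expressions are read as polynomials in $a_2,a_3,a_4$ after cancelling the factor $a_2$, that is, \[ \beta_1=a_2^{p-3}a_3\Bigl(\tfrac32a_2^3+a_3^2-a_2a_4\Bigr),\qquad \gamma_1=-a_2^{p-3}\Bigl(\tfrac32a_2^2-a_4\Bigr)\Bigl(\tfrac32a_2^3+a_3^2-a_2a_4\Bigr), \] so that they are also defined when $a_2=0$ (with $a_2^{0}=1$). Then \[ f^p(\zeta)\equiv \zeta+\alpha_1\zeta^{2p+3}+\beta_1\zeta^{2p+4}+\gamma_1\zeta^{2p+5} \pmod{\langle\zeta^{2p+6}\rangle},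 \] where $\langle\zeta^{2p+6}\rangle$ is the ideal of $k[[\zeta]]$ generated by $\zeta^{2p+6}$. -/

import Mathlib

open PowerSeries

/-- The formal power series `ζ (1 + ∑_{j ≥ 2} a_j ζ^j)`. The values `a 0` and `a 1` are not used. -/
noncomputable def parabolicSeries {k : Type*} [Field k] (a : ℕ → k) : PowerSeries k :=
  X * (1 + PowerSeries.mk (fun j => if 2 ≤ j then a j else 0))

/-- The `n`-th iterate of a power series under composition: `f^0 = ζ`, `f^(n+1) = f^n ∘ f`.
Here `PowerSeries.subst f g` is `g(f(ζ))`; it is the usual composition for `f` with zero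
constant term. -/
noncomputable def compIterate {k : Type*} [Field k] (f : PowerSeries k) : ℕ → PowerSeries k
  | 0 => X
  | n + 1 => PowerSeries.subst f (compIterate f n)

/-! ### Substitution operators acting on leading coefficients -/

section AlgHom

variable {k : Type*} [Field k]

/-! Let `T` be the substitution `g ↦ g ∘ f`. In characteristic `p`, `(T - 1)^p = T^p - 1`, so `f^p -
X = (T - 1)^p X`. Each application of `T - 1` to a multiple of `X` raises the order by at least 2
and acts on three leading coefficients by a triangular recursion (`algHom_sub_self_of_cubic`). If
`a₂ ≠ 0`, after `p` steps the first two vanish and Wilson's theorem gives the third, `α`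
(`exists_expansion_of_cubic`, `sum_mul_prod_erase_eq`). Since `f^p` commutes with `f`, `α` then
determines the next two (`coeff_relations_of_commute`). If `a₂ = 0`, the order rises by at least 3:
for `p ≥ 5` nothing survives below `X^(2p+6)`, and `p = 3` is a direct computation. -/

theorem exists_eq_C_add_X_mul (r : PowerSeries k) : ∃ (c : k) (s : PowerSeries k), r = C c + X * s := by
  obtain ⟨s, hs⟩ := X_dvd_iff.2 (show constantCoeff (r - C (constantCoeff r)) = 0 by simp)
  exact ⟨constantCoeff r, s, by rw [← hs]; ring⟩

theorem algHom_C (T : PowerSeries k →ₐ[k] PowerSeries k) (c : k) : T (C c) = C c :=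
  T.commutes c

/-- An endomorphism that fixes `X` modulo `X ^ N` is the identity modulo `X ^ N`. -/
theorem X_pow_dvd_algHom_sub (T : PowerSeries k →ₐ[k] PowerSeries k) {N : ℕ}
    (hN : (X : PowerSeries k) ^ N ∣ T X - X) (r : PowerSeries k) : X ^ N ∣ T r - r := by
  have key : ∀ j ≤ N, ∀ r : PowerSeries k, X ^ j ∣ T r - r := by
    intro j
    induction j with
    | zero => simp
    | succ j ih =>
      intro hj r
      obtain ⟨c, s, rfl⟩ := exists_eq_C_add_X_mul r
      have h1 : T (C c + X * s) - (C c + X * s) = (T X - X) * T s + X * (T s - s) := by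
        rw [map_add, map_mul, algHom_C]; ring
      rw [h1]
      refine dvd_add ((pow_dvd_pow X hj).trans (hN.mul_right _)) ?_
      rw [pow_succ']
      exact mul_dvd_mul_left X (ih (Nat.le_of_succ_le hj) s)
  exact key N le_rfl r

theorem one_add_pow_eq_one_add_mul {R : Type*} [CommRing R] (u : R) (n : ℕ) :
    ∃ s, (1 + u) ^ n = 1 + u * s := by
  induction n with
  | zero => exact ⟨0, by simp⟩
  | succ n ih =>
    obtain ⟨s, hs⟩ := ih
    exact ⟨1 + s + u * s, by rw [pow_succ, hs]; ring⟩

theorem one_add_pow_eq_linear {R : Type*} [CommRing R] (u : R) (n : ℕ) :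
    ∃ s, (1 + u) ^ n = 1 + n * u + u ^ 2 * s := by
  induction n with
  | zero => exact ⟨0, by simp⟩
  | succ n ih =>
    obtain ⟨s, hs⟩ := ih
    exact ⟨n + s + u * s, by rw [pow_succ, hs]; push_cast; ring⟩

/-- For an odd exponent the binomial coefficient `m * (2m + 1)` involves no division by 2. -/
theorem one_add_pow_odd_eq_quadratic {R : Type*} [CommRing R] (u : R) (m : ℕ) :
    ∃ s, (1 + u) ^ (2 * m + 1) = 1 + (2 * m + 1) * u + m * (2 * m + 1) * u ^ 2 + u ^ 3 * s := by
  induction m with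
  | zero => exact ⟨0, by simp⟩
  | succ m ih =>
    obtain ⟨s, hs⟩ := ih
    refine ⟨(2 * m + 1) + 2 * m * (2 * m + 1) + m * (2 * m + 1) * u + s * (1 + u) ^ 2, ?_⟩
    rw [show 2 * (m + 1) + 1 = (2 * m + 1) + 2 by ring, pow_add, hs]; push_cast; ring

/-- The effect of `T - 1` on the three leading coefficients, for `T` the substitution of
`X * (1 + a₂ X² + a₃ X³ + a₄ X⁴ + ⋯)`. -/
theorem algHom_sub_self_of_cubic (T : PowerSeries k →ₐ[k] PowerSeries k) (a₂ a₃ a₄ : k)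
    (r : PowerSeries k)
    (hT : T X = X * (1 + X ^ 2 * (C a₂ + X * (C a₃ + X * (C a₄ + X * r))))) (m : ℕ) (c₀ c₁ c₂ : k)
    (R : PowerSeries k) :
    ∃ R', T (X ^ (2 * m + 1) * (C c₀ + C c₁ * X + C c₂ * X ^ 2 + X ^ 3 * R)) -
        X ^ (2 * m + 1) * (C c₀ + C c₁ * X + C c₂ * X ^ 2 + X ^ 3 * R) =
      X ^ (2 * (m + 1) + 1) * (C ((2 * m + 1) * a₂ * c₀) +
        C ((2 * m + 2) * a₂ * c₁ + (2 * m + 1) * a₃ * c₀) * X +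
        C ((2 * m + 3) * a₂ * c₂ + (2 * m + 2) * a₃ * c₁ +
          (2 * m + 1) * (a₄ + m * a₂ ^ 2) * c₀) * X ^ 2 + X ^ 3 * R') := by
  obtain ⟨R₂, hR₂⟩ := X_pow_dvd_algHom_sub T (N := 2) (by
    rw [hT]
    exact ⟨X * (C a₂ + X * (C a₃ + X * (C a₄ + X * r))), by ring⟩) R
  set w := C a₃ + X * (C a₄ + X * r) with hw
  set v := C a₂ + X * w with hv
  obtain ⟨s₀, h₀⟩ := one_add_pow_odd_eq_quadratic (X ^ 2 * v) m
  obtain ⟨s₁, h₁⟩ := one_add_pow_eq_linear (X ^ 2 * v) (2 * m + 1 + 1)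
  obtain ⟨s₂, h₂⟩ := one_add_pow_eq_linear (X ^ 2 * v) (2 * m + 1 + 2)
  obtain ⟨s₃, h₃⟩ := one_add_pow_eq_one_add_mul (X ^ 2 * v) (2 * m + 1 + 3)
  have e : T (X ^ (2 * m + 1) * (C c₀ + C c₁ * X + C c₂ * X ^ 2 + X ^ 3 * R)) =
      X ^ (2 * m + 1) * ((1 + X ^ 2 * v) ^ (2 * m + 1) * C c₀ +
        (1 + X ^ 2 * v) ^ (2 * m + 1 + 1) * C c₁ * X +
        (1 + X ^ 2 * v) ^ (2 * m + 1 + 2) * C c₂ * X ^ 2 +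
        (1 + X ^ 2 * v) ^ (2 * m + 1 + 3) * X ^ 3 * (R + X ^ 2 * R₂)) := by
    simp only [map_mul, map_add, map_pow, algHom_C, hT, mul_pow]
    rw [← hR₂]; ring
  rw [e, h₀, h₁, h₂, h₃]
  refine ⟨C c₀ * (2 * (m : PowerSeries k) + 1) * r +
    C c₀ * (m : PowerSeries k) * (2 * (m : PowerSeries k) + 1) * w * (v + C a₂) + C c₀ * X * v ^ 3 * s₀ +
    C c₁ * (2 * (m : PowerSeries k) + 2) * (C a₄ + X * r) + C c₁ * v ^ 2 * s₁ +
    C c₂ * (2 * (m : PowerSeries k) + 3) * w +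
    C c₂ * X * v ^ 2 * s₂ + v * s₃ * (R + X ^ 2 * R₂) + R₂, ?_⟩
  simp only [map_mul, map_add, map_pow, map_natCast, map_ofNat, map_one]
  push_cast
  rw [hv, hw]
  ring

/-- The effect of `T - 1` on the two leading coefficients, for `T` the substitution of
`X * (1 + a₃ X³ + a₄ X⁴ + ⋯)`. -/
theorem algHom_sub_self_of_quartic (T : PowerSeries k →ₐ[k] PowerSeries k) (a₃ a₄ : k)
    (r : PowerSeries k) (hT : T X = X * (1 + X ^ 3 * (C a₃ + X * (C a₄ + X * r)))) (n : ℕ)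
    (c₀ c₁ : k) (R : PowerSeries k) :
    ∃ R', T (X ^ n * (C c₀ + C c₁ * X + X ^ 2 * R)) - X ^ n * (C c₀ + C c₁ * X + X ^ 2 * R) =
      X ^ (n + 3) * (C (n * a₃ * c₀) + C ((n + 1) * a₃ * c₁ + n * a₄ * c₀) * X + X ^ 2 * R') := by
  obtain ⟨R₂, hR₂⟩ := X_pow_dvd_algHom_sub T (N := 3) (by
    rw [hT]
    exact ⟨X * (C a₃ + X * (C a₄ + X * r)), by ring⟩) R
  set w := C a₄ + X * r with hw
  set v := C a₃ + X * w with hv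
  obtain ⟨s₀, h₀⟩ := one_add_pow_eq_linear (X ^ 3 * v) n
  obtain ⟨s₁, h₁⟩ := one_add_pow_eq_linear (X ^ 3 * v) (n + 1)
  obtain ⟨s₂, h₂⟩ := one_add_pow_eq_one_add_mul (X ^ 3 * v) (n + 2)
  have e : T (X ^ n * (C c₀ + C c₁ * X + X ^ 2 * R)) =
      X ^ n * ((1 + X ^ 3 * v) ^ n * C c₀ + (1 + X ^ 3 * v) ^ (n + 1) * C c₁ * X +
        (1 + X ^ 3 * v) ^ (n + 2) * X ^ 2 * (R + X ^ 3 * R₂)) := by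
    simp only [map_mul, map_add, map_pow, algHom_C, hT, mul_pow]
    rw [← hR₂]; ring
  rw [e, h₀, h₁, h₂]
  refine ⟨C c₀ * (n : PowerSeries k) * r + C c₀ * X * v ^ 2 * s₀ +
    C c₁ * ((n : PowerSeries k) + 1) * w + C c₁ * X ^ 2 * v ^ 2 * s₁ +
    v * s₂ * (R + X ^ 3 * R₂) + R₂, ?_⟩
  simp only [map_mul, map_add, map_natCast, map_one]
  push_cast
  rw [hv, hw]
  ring

theorem eq_zero_of_X_pow_dvd {x y z : k}
    (h : (X : PowerSeries k) ^ 3 ∣ C x + C y * X + C z * X ^ 2) : x = 0 ∧ y = 0 ∧ z = 0 := by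
  rw [X_pow_dvd_iff] at h
  have h0 := h 0 (by norm_num)
  have h1 := h 1 (by norm_num)
  have h2 := h 2 (by norm_num)
  simp [coeff_X_pow, coeff_C, coeff_C_mul] at h0 h1 h2
  exact ⟨h0, h1, h2⟩

/-- If `X + X ^ N * (g₀ + g₁ X + g₂ X² + ⋯)` commutes with `X + a₂ X³ + a₃ X⁴ + a₄ X⁵ + ⋯` under
composition and `N = 3` in `k`, then the coefficients `g₁` and `g₂` are determined by `g₀`. -/
theorem coeff_relations_of_commute (T S : PowerSeries k →ₐ[k] PowerSeries k) (a₂ a₃ a₄ : k)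
    (r : PowerSeries k)
    (hT : T X = X * (1 + X ^ 2 * (C a₂ + X * (C a₃ + X * (C a₄ + X * r))))) (q : ℕ)
    (hq₀ : q ≠ 0)
    (hq : (q : k) = 0) (g₀ g₁ g₂ : k) (R : PowerSeries k)
    (hS : S X = X + X ^ (2 * (q + 1) + 1) * (C g₀ + C g₁ * X + C g₂ * X ^ 2 + X ^ 3 * R))
    (hTS : T (S X) = S (T X)) :
    a₂ * g₁ = a₃ * g₀ ∧ 2 * a₂ * g₂ = (2 * a₄ - 3 * a₂ ^ 2) * g₀ := by
  obtain ⟨R', hR'⟩ := algHom_sub_self_of_cubic T a₂ a₃ a₄ r hT (q + 1) g₀ g₁ g₂ R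
  set G := C g₀ + C g₁ * X + C g₂ * X ^ 2 + X ^ 3 * R with hG
  obtain ⟨r', hr'⟩ := X_pow_dvd_algHom_sub S (N := 2 * (q + 1) + 1)
    (by rw [hS]; exact ⟨G, by ring⟩) r
  -- `q ≥ 1` makes the order `N = 2q + 3` at least 5, so terms quadratic in `G`, of order at least
  -- `2N + 1`, lie beyond the compared range `X^(N+2), ..., X^(N+4)`.
  obtain ⟨j, rfl⟩ : ∃ j, q = j + 1 := Nat.exists_eq_succ_of_ne_zero hq₀
  have hN : (X : PowerSeries k) ^ (2 * (j + 1 + 1) + 1) = X ^ 5 * X ^ (2 * j) := by ring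
  have hN' : (X : PowerSeries k) ^ (2 * (j + 1 + 1 + 1) + 1) = X ^ 7 * X ^ (2 * j) := by ring
  have hY : (X : PowerSeries k) ^ 7 * X ^ (2 * j) ≠ 0 := by simp [X_ne_zero]
  have hTS' : S (T X) = S X * (1 + S X ^ 2 * (C a₂ + S X * (C a₃ + S X * (C a₄ + S X * S r)))) := by
    rw [hT]; simp only [map_mul, map_add, map_pow, algHom_C, map_one]
  have hTS'' : T (S X) = T X + (T (X ^ (2 * (j + 1 + 1) + 1) * G) - X ^ (2 * (j + 1 + 1) + 1) * G) +
      X ^ (2 * (j + 1 + 1) + 1) * G := by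
    rw [hS, map_add]; ring
  have hr : S r = r + X ^ (2 * (j + 1 + 1) + 1) * r' := by rw [← hr']; ring
  have hj : (j : k) = -1 := by push_cast at hq; linear_combination hq
  rw [hTS', hTS'', hR', hT, hr, hS, hN, hN'] at hTS
  generalize (X : PowerSeries k) ^ (2 * j) = Y at hTS hY
  -- The constant entry is 0 because both sides contribute `3 * a₂ * g₀`: `N = 3` in `k`.
  have hdvd : (X : PowerSeries k) ^ 3 ∣ C 0 + C (a₂ * g₁ - a₃ * g₀) * X +
      C (2 * a₂ * g₂ - (2 * a₄ - 3 * a₂ ^ 2) * g₀) * X ^ 2 := by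
    refine ⟨3 * C a₂ * R + 4 * C a₃ * (C g₂ + X * R) + 5 * C a₄ * (C g₁ + C g₂ * X + X ^ 2 * R) - R' +
      C a₂ * (3 * X * Y * G ^ 2 + X ^ 5 * Y ^ 2 * G ^ 3) +
      C a₃ * (6 * X ^ 2 * Y * G ^ 2 + 4 * X ^ 6 * Y ^ 2 * G ^ 3 + X ^ 10 * Y ^ 3 * G ^ 4) +
      C a₄ * Y * (10 * X ^ 3 * G ^ 2 + 10 * X ^ 7 * Y * G ^ 3 + 5 * X ^ 11 * Y ^ 2 * G ^ 4 +
        X ^ 15 * Y ^ 3 * G ^ 5) + X * (1 + X ^ 4 * Y * G) ^ 6 * r' +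
      r * G * (6 + 15 * (X ^ 4 * Y * G) + 20 * (X ^ 4 * Y * G) ^ 2 + 15 * (X ^ 4 * Y * G) ^ 3 +
        6 * (X ^ 4 * Y * G) ^ 4 + (X ^ 4 * Y * G) ^ 5), ?_⟩
    apply mul_left_cancel₀ hY
    push_cast [hj] at hTS
    simp only [map_mul, map_add, map_sub, map_neg, map_pow, map_ofNat, map_one, map_zero] at hTS ⊢
    have hGX := congrArg (fun g => (X ^ 7 * Y) * (3 * C a₂ + 4 * C a₃ * X + 5 * C a₄ * X ^ 2) * g) hG
    linear_combination hTS + hGX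
  obtain ⟨-, h₁, h₂⟩ := eq_zero_of_X_pow_dvd hdvd
  exact ⟨sub_eq_zero.1 h₁, sub_eq_zero.1 h₂⟩

end AlgHom

section Recursion

variable {k : Type*} [Field k]

/-- As 2 is invertible, `2i + 3` runs once through the residues mod `p`, and `j` gives 0. The others
multiply to `-1` by Wilson's theorem. -/
theorem prod_erase_two_mul_add_three (p : ℕ) (hp : p.Prime) (hp2 : p ≠ 2) [CharP k p] (j : ℕ)
    (hj : 2 * j + 3 = p) : ∏ i ∈ (Finset.range p).erase j, (2 * (i : k) + 3) = -1 := by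
  have : Fact p.Prime := ⟨hp⟩
  have h2 : (2 : ZMod p) ≠ 0 := by
    intro h
    have h' : ((2 : ℕ) : ZMod p) = 0 := by exact_mod_cast h
    exact hp2 ((Nat.prime_dvd_prime_iff_eq hp Nat.prime_two).1 ((ZMod.natCast_eq_zero_iff 2 p).1 h'))
  have hj0 : (2 * (j : ZMod p) + 3) = 0 := by
    have : ((2 * j + 3 : ℕ) : ZMod p) = 0 := by rw [hj]; simp
    exact_mod_cast this
  have hinj : Set.InjOn (fun i : ℕ => 2 * (i : ZMod p) + 3) (Finset.range p) := by
    intro x hx y hy hxy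
    have h3 : (x : ZMod p) = y := mul_left_cancel₀ h2 (add_right_cancel hxy)
    rw [ZMod.natCast_eq_natCast_iff'] at h3
    rwa [Nat.mod_eq_of_lt (by simpa using hx), Nat.mod_eq_of_lt (by simpa using hy)] at h3
  have himg : ((Finset.range p).erase j).image (fun i : ℕ => 2 * (i : ZMod p) + 3) =
      (Finset.univ : Finset (ZMod p)).erase 0 := by
    apply Finset.eq_of_subset_of_card_le
    · intro x hx
      obtain ⟨i, hi, rfl⟩ := Finset.mem_image.1 hx
      rw [Finset.mem_erase] at hi
      refine Finset.mem_erase.2 ⟨fun h0 => hi.1 (hinj hi.2 ?_ (h0.trans hj0.symm)), Finset.mem_univ _⟩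
      simp; omega
    · rw [Finset.card_image_of_injOn (hinj.mono (by simp)),
        Finset.card_erase_of_mem (Finset.mem_univ _), Finset.card_univ, ZMod.card,
        Finset.card_erase_of_mem (by simp; omega), Finset.card_range]
  have hprod : ∏ i ∈ (Finset.range p).erase j, (2 * (i : ZMod p) + 3) = -1 := by
    rw [← Finset.prod_image (f := fun x : ZMod p => x) (hinj.mono (by simp)), himg,
      ← ZMod.prod_Ico_one_prime p]
    symm
    refine Finset.prod_bij (fun i _ => (i : ZMod p)) ?_ ?_ ?_ fun _ _ => rfl
    · intro i hi
      rw [Finset.mem_Ico] at hi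
      refine Finset.mem_erase.2 ⟨fun h => ?_, Finset.mem_univ _⟩
      exact absurd (Nat.le_of_dvd (by omega) ((ZMod.natCast_eq_zero_iff i p).1 h)) (by omega)
    · intro x hx y hy hxy
      rw [Finset.mem_Ico] at hx hy
      rwa [ZMod.natCast_eq_natCast_iff', Nat.mod_eq_of_lt hx.2, Nat.mod_eq_of_lt hy.2] at hxy
    · intro x hx
      refine ⟨x.val, Finset.mem_Ico.2 ⟨?_, ZMod.val_lt x⟩, ZMod.natCast_zmod_val x⟩
      exact Nat.one_le_iff_ne_zero.2 ((ZMod.val_ne_zero x).2 (Finset.ne_of_mem_erase hx))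
  have := congrArg (ZMod.castHom (dvd_refl p) k) hprod
  simpa only [map_prod, map_add, map_mul, map_natCast, map_ofNat, map_neg, map_one] using this

/-- Solution of the linear recursion `s (m + 1) = u m * s m + w m * ∏ i < m, u i`. -/
theorem sum_mul_prod_erase_succ (u w : ℕ → k) (m : ℕ) :
    ∑ j ∈ Finset.range (m + 1), w j * ∏ i ∈ (Finset.range (m + 1)).erase j, u i =
      u m * ∑ j ∈ Finset.range m, w j * ∏ i ∈ (Finset.range m).erase j, u i +
        w m * ∏ i ∈ Finset.range m, u i := by
  rw [Finset.sum_range_succ, Finset.mul_sum]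
  congr 1
  · refine Finset.sum_congr rfl fun j hj => ?_
    rw [Finset.range_add_one, Finset.erase_insert_of_ne (Finset.mem_range.1 hj).ne',
      Finset.prod_insert (by simp)]
    ring
  · rw [Finset.range_add_one, Finset.erase_insert (by simp)]

theorem sum_mul_prod_erase_eq (p : ℕ) (hp : p.Prime) (hp2 : p ≠ 2) [CharP k p] (w : ℕ → k) (j : ℕ)
    (hj : 2 * j + 3 = p) :
    ∑ l ∈ Finset.range p, w l * ∏ i ∈ (Finset.range p).erase l, (2 * (i : k) + 3) = -w j := by
  have hj0 : (2 * (j : k) + 3) = 0 := by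
    have : ((2 * j + 3 : ℕ) : k) = 0 := by rw [hj]; simp
    exact_mod_cast this
  have hjp : j ∈ Finset.range p := by simp; omega
  rw [Finset.sum_eq_single_of_mem j hjp, prod_erase_two_mul_add_three p hp hp2 j hj]
  · ring
  · intro l _ hl
    rw [Finset.prod_eq_zero (Finset.mem_erase.2 ⟨hl.symm, hjp⟩) hj0, mul_zero]

end Recursion

/-! ### Iterates of `f` and of `T - 1` -/

section Iterates

variable {k : Type*} [Field k]

theorem constantCoeff_compIterate {f : PowerSeries k} (hf : constantCoeff f = 0) (n : ℕ) :
    constantCoeff (compIterate f n) = 0 := by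
  induction n with
  | zero => simp [compIterate]
  | succ n ih => exact constantCoeff_subst_eq_zero hf _ ih

theorem substAlgHom_pow_apply {f : PowerSeries k} (hf : constantCoeff f = 0) (n : ℕ)
    (g : PowerSeries k) :
    ((substAlgHom (R := k) (HasSubst.of_constantCoeff_zero hf)).toLinearMap ^ n) g =
      subst (compIterate f n) g := by
  induction n with
  | zero => simp [compIterate, X_subst]
  | succ n ih =>
    rw [pow_succ', Module.End.mul_apply, ih, AlgHom.toLinearMap_apply, coe_substAlgHom, compIterate,
      subst_comp_subst_apply
        (HasSubst.of_constantCoeff_zero (constantCoeff_compIterate hf n))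
        (HasSubst.of_constantCoeff_zero hf)]

theorem sub_one_pow_char_apply (p : ℕ) (hp : p.Prime) [CharP k p]
    (T : Module.End k (PowerSeries k)) (g : PowerSeries k) :
    ((T - 1) ^ p) g = (T ^ p) g - g := by
  have : Fact p.Prime := ⟨hp⟩
  have : CharP (Module.End k (PowerSeries k)) p :=
    charP_of_injective_algebraMap
      (FaithfulSMul.algebraMap_injective k (Module.End k (PowerSeries k))) p
  rw [sub_pow_char_of_commute p (Commute.one_right T)]
  simp

/-- Closed solution of the recursion. The factors `2m + 1`, `a₂`, `a₂ ^ 2` on the left avoid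
division and match the coupling terms. -/
theorem exists_expansion_of_cubic (T : PowerSeries k →ₐ[k] PowerSeries k) (a₂ a₃ a₄ : k)
    (r : PowerSeries k)
    (hT : T X = X * (1 + X ^ 2 * (C a₂ + X * (C a₃ + X * (C a₄ + X * r))))) (m : ℕ) :
    ∃ (c₀ c₁ c₂ : k) (R : PowerSeries k), ((T.toLinearMap - 1) ^ m) X =
        X ^ (2 * m + 1) * (C c₀ + C c₁ * X + C c₂ * X ^ 2 + X ^ 3 * R) ∧
      (2 * m + 1) * c₀ = a₂ ^ m * ∏ i ∈ Finset.range m, (2 * (i : k) + 3) ∧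
      a₂ * c₁ = a₂ ^ m * a₃ * (∏ i ∈ Finset.range m, (2 * (i : k) + 3) -
        ∏ i ∈ Finset.range m, (2 * (i : k) + 2)) ∧
      a₂ ^ 2 * c₂ = a₂ ^ m * (∑ j ∈ Finset.range m,
          (a₂ * a₄ + (2 * j + 2) * a₃ ^ 2 + j * a₂ ^ 3) *
            ∏ i ∈ (Finset.range m).erase j, (2 * (i : k) + 3) +
        a₃ ^ 2 * (2 * ∏ i ∈ Finset.range m, (2 * (i : k) + 3) -
          ∏ i ∈ Finset.range (m + 1), (2 * (i : k) + 2))) := by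
  induction m with
  | zero => exact ⟨1, 0, 0, 0, by simp, by simp, by simp, by simp⟩
  | succ m ih =>
    obtain ⟨c₀, c₁, c₂, R, h, h₀, h₁, h₂⟩ := ih
    obtain ⟨R', hR'⟩ := algHom_sub_self_of_cubic T a₂ a₃ a₄ r hT m c₀ c₁ c₂ R
    refine ⟨_, _, _, R', by rw [pow_succ', Module.End.mul_apply, h]; exact hR', ?_, ?_, ?_⟩
    · rw [Finset.prod_range_succ]
      push_cast
      linear_combination (2 * (m : k) + 3) * a₂ * h₀
    · simp only [Finset.prod_range_succ]
      linear_combination (2 * (m : k) + 2) * a₂ * h₁ + a₂ * a₃ * h₀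
    · rw [sum_mul_prod_erase_succ]
      simp only [Finset.prod_range_succ] at h₂ ⊢
      push_cast
      linear_combination (2 * (m : k) + 3) * a₂ * h₂ + (2 * (m : k) + 2) * a₃ * a₂ * h₁ +
        a₂ ^ 2 * (a₄ + m * a₂ ^ 2) * h₀

theorem exists_expansion_of_quartic (T : PowerSeries k →ₐ[k] PowerSeries k) (a₃ a₄ : k)
    (r : PowerSeries k) (hT : T X = X * (1 + X ^ 3 * (C a₃ + X * (C a₄ + X * r)))) (m : ℕ) :
    ∃ R : PowerSeries k, ((T.toLinearMap - 1) ^ m) X = X ^ (3 * m + 1) * R := by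
  induction m with
  | zero => exact ⟨1, by simp⟩
  | succ m ih =>
    obtain ⟨R, h⟩ := ih
    obtain ⟨c₀, s, rfl⟩ := exists_eq_C_add_X_mul R
    obtain ⟨c₁, s, rfl⟩ := exists_eq_C_add_X_mul s
    obtain ⟨R', hR'⟩ := algHom_sub_self_of_quartic T a₃ a₄ r hT (3 * m + 1) c₀ c₁ s
    exact ⟨_, by
      rw [pow_succ', Module.End.mul_apply, h,
        show C c₀ + X * (C c₁ + X * s) = C c₀ + C c₁ * X + X ^ 2 * s by ring]
      exact hR'⟩

theorem third_difference_of_quartic [CharP k 3] (T : PowerSeries k →ₐ[k] PowerSeries k)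
    (a₃ a₄ : k) (r : PowerSeries k)
    (hT : T X = X * (1 + X ^ 3 * (C a₃ + X * (C a₄ + X * r)))) :
    ∃ R : PowerSeries k, ((T.toLinearMap - 1 : Module.End k (PowerSeries k)) ^ 3) X =
      X ^ 10 * (C (a₃ ^ 3) + C (a₃ ^ 2 * a₄) * X + X ^ 2 * R) := by
  have h3 : (3 : k) = 0 := by exact_mod_cast CharP.cast_eq_zero k 3
  obtain ⟨R₁, h₁⟩ := algHom_sub_self_of_quartic T a₃ a₄ r hT 1 1 0 0
  obtain ⟨R₂, h₂⟩ := algHom_sub_self_of_quartic T a₃ a₄ r hT (1 + 3) _ _ R₁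
  obtain ⟨R₃, h₃⟩ := algHom_sub_self_of_quartic T a₃ a₄ r hT (1 + 3 + 3) _ _ R₂
  refine ⟨R₃, ?_⟩
  rw [← h₂, ← h₁] at h₃
  have e : (X : PowerSeries k) ^ 1 * (C 1 + C 0 * X + X ^ 2 * 0) = X := by simp
  rw [e] at h₃
  have e' : ((T.toLinearMap - 1 : Module.End k (PowerSeries k)) ^ 3) X =
      T (T (T X - X) - (T X - X)) - (T (T X - X) - (T X - X)) := by
    simp [pow_succ]
  rw [e', h₃]
  congr 4 <;> congr 1
  · push_cast; linear_combination 9 * a₃ ^ 3 * h3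
  · push_cast; linear_combination 33 * a₃ ^ 2 * a₄ * h3

end Iterates

/-! ### The congruence for `f^p` -/

theorem mainTheorem2 {k : Type*} [Field k] (p : ℕ) (hp : p.Prime) (hp2 : p ≠ 2) [CharP k p]
    (a : ℕ → k) (φ α β γ : k)
    (hφ : φ = 3 / 2 * a 2 ^ 3 + a 3 ^ 2 - a 2 * a 4)
    (hα : α = a 2 ^ (p - 2) * φ)
    (hβ : β = a 2 ^ (p - 3) * a 3 * φ)
    (hγ : γ = -(a 2 ^ (p - 3) * (3 / 2 * a 2 ^ 2 - a 4) * φ)) :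
    (compIterate (parabolicSeries a) p -
        (X + C α * X ^ (2 * p + 3) + C β * X ^ (2 * p + 4) + C γ * X ^ (2 * p + 5))
      ∈ Ideal.span {(X : PowerSeries k) ^ (2 * p + 6)}) ∧
    (a 2 ≠ 0 → β = a 3 / a 2 * α ∧ γ = -(3 * a 2 / 2 - a 4 / a 2) * α) := by
  have hp3 : 3 ≤ p := by have := hp.two_le; omega
  obtain ⟨j, hj⟩ : ∃ j, 2 * j + 3 = p := by
    obtain ⟨i, hi⟩ := hp.odd_of_ne_two hp2
    exact ⟨i - 1, by omega⟩
  have h2 : (2 : k) ≠ 0 := by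
    intro h
    have h' : ((2 : ℕ) : k) = 0 := by exact_mod_cast h
    exact hp2 ((Nat.prime_dvd_prime_iff_eq hp Nat.prime_two).1 ((CharP.cast_eq_zero_iff k p 2).1 h'))
  have hpk : (p : k) = 0 := CharP.cast_eq_zero k p
  have hα' : α = a 2 * a 2 ^ (p - 3) * φ := by
    rw [hα, ← pow_succ', show p - 3 + 1 = p - 2 by omega]
  refine ⟨?_, fun ha => ?_⟩
  swap
  · rw [hβ, hγ, hα']
    constructor <;> field_simp
  set f := parabolicSeries a with hf
  obtain ⟨r, hr⟩ : ∃ r, f = X * (1 + X ^ 2 * (C (a 2) + X * (C (a 3) + X * (C (a 4) + X * r)))) := by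
    refine ⟨mk fun n => a (n + 5), ?_⟩
    rw [hf, parabolicSeries]
    congr 2
    ext n
    match n with
    | 0 => simp
    | 1 => simp [pow_succ', mul_assoc]
    | 2 => simp [pow_succ', mul_assoc, coeff_succ_X_mul]
    | 3 => simp [pow_succ', mul_assoc, coeff_succ_X_mul]
    | 4 => simp [pow_succ', mul_assoc, coeff_succ_X_mul]
    | n + 5 => simp [pow_succ', mul_assoc, coeff_succ_X_mul]
  have hf0 : constantCoeff f = 0 := by rw [hr]; simp
  set T := substAlgHom (R := k) (HasSubst.of_constantCoeff_zero hf0) with hTdef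
  have hT : T X = f := by rw [hTdef, coe_substAlgHom, subst_X (HasSubst.of_constantCoeff_zero hf0)]
  have hTp : (T.toLinearMap ^ p) X = compIterate f p := by
    rw [hTdef, substAlgHom_pow_apply hf0,
      subst_X (HasSubst.of_constantCoeff_zero (constantCoeff_compIterate hf0 p))]
  have hdiff : compIterate f p = X + ((T.toLinearMap - 1) ^ p) X := by
    rw [sub_one_pow_char_apply p hp, hTp]; ring
  rw [Ideal.mem_span_singleton]
  by_cases ha : a 2 = 0
  · have hT' : T X = X * (1 + X ^ 3 * (C (a 3) + X * (C (a 4) + X * r))) := by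
      rw [hT, hr, ha, map_zero]; ring
    by_cases hp3' : p = 3
    · subst hp3'
      obtain ⟨R, hR⟩ := third_difference_of_quartic T _ _ r hT'
      have h0 : α = 0 := by rw [hα, ha]; simp
      have h1 : β = a 3 ^ 3 := by rw [hβ, hφ, ha]; simp; ring
      have h2 : γ = a 3 ^ 2 * a 4 := by rw [hγ, hφ, ha]; simp; ring
      rw [hdiff, hR, h0, h1, h2]
      exact ⟨R, by simp only [map_zero]; ring⟩
    · obtain ⟨R, hR⟩ := exists_expansion_of_quartic T _ _ r hT' p
      have hp5 : 5 ≤ p := by omega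
      have h0 : a 2 ^ (p - 3) = 0 := by rw [ha]; exact zero_pow (by omega)
      rw [hdiff, hR, hα', hβ, hγ, h0]
      exact ⟨X ^ (p - 5) * R, by
        rw [← mul_assoc, ← pow_add, show 2 * p + 6 + (p - 5) = 3 * p + 1 by omega]; simp⟩
  · obtain ⟨c₀, c₁, c₂, R, h, h₀, h₁, h₂⟩ :=
      exists_expansion_of_cubic T _ _ _ r (hT.trans hr) p
    have hP : ∏ i ∈ Finset.range p, (2 * (i : k) + 3) = 0 :=
      Finset.prod_eq_zero (i := j) (by simp; omega) (by rw [← hj] at hpk; exact_mod_cast hpk)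
    have hQ : ∏ i ∈ Finset.range p, (2 * (i : k) + 2) = 0 :=
      Finset.prod_eq_zero (i := p - 1) (by simp; omega) (by
        rw [Nat.cast_sub (by omega), hpk]; simp)
    rw [sum_mul_prod_erase_eq p hp hp2 (fun j => a 2 * a 4 + (2 * j + 2) * a 3 ^ 2 + j * a 2 ^ 3) j hj,
      Finset.prod_range_succ, hP, hQ] at h₂
    rw [hP, hpk] at h₀
    rw [hP, hQ] at h₁
    have hc₀ : c₀ = 0 := by linear_combination h₀
    have hc₁ : c₁ = 0 := by simpa [ha] using h₁
    -- This `j` is the only surviving index of the sum; here `2j + 2 = -1`, which turns its weight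
    -- into `-φ`.
    have hjk : (j : k) = -3 / 2 := by
      field_simp
      rw [← hj] at hpk
      push_cast at hpk
      linear_combination hpk
    have hc₂ : c₂ = α := by
      apply mul_left_cancel₀ (pow_ne_zero 2 ha)
      rw [h₂, hα, ← mul_assoc, ← pow_add, show 2 + (p - 2) = p by omega, hjk, hφ]
      field_simp
      ring
    -- With `c₀ = c₁ = 0` the series starts at `α * X^(2p+3)`; `g₁`, `g₂` lie beyond the recursion's
    -- reach.
    obtain ⟨g₁, R, rfl⟩ := exists_eq_C_add_X_mul R
    obtain ⟨g₂, R, rfl⟩ := exists_eq_C_add_X_mul R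
    have hh : compIterate f p =
        X + X ^ (2 * (p + 1) + 1) * (C α + C g₁ * X + C g₂ * X ^ 2 + X ^ 3 * R) := by
      rw [hdiff, h, hc₀, hc₁, hc₂, map_zero]; ring
    have hs := HasSubst.of_constantCoeff_zero (constantCoeff_compIterate hf0 p)
    have hS : substAlgHom (R := k) hs X = compIterate f p := by rw [coe_substAlgHom, subst_X hs]
    obtain ⟨e₁, e₂⟩ := coeff_relations_of_commute T (substAlgHom (R := k) hs) _ _ _ r (hT.trans hr) p
      hp.ne_zero hpk α g₁ g₂ R (hS.trans hh) (by
        rw [hS, coe_substAlgHom hs, ← substAlgHom_pow_apply hf0, ← hTdef, ← hTp]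
        change (T.toLinearMap * T.toLinearMap ^ p) X = (T.toLinearMap ^ p * T.toLinearMap) X
        rw [← pow_succ', ← pow_succ])
    have hg₁ : g₁ = β := by
      apply mul_left_cancel₀ ha
      rw [e₁, hα', hβ]; ring
    have hg₂ : g₂ = γ := by
      apply mul_left_cancel₀ (mul_ne_zero h2 ha)
      rw [e₂, hα', hγ]; field_simp; ring
    rw [hh, hg₁, hg₂]
    exact ⟨R, by ring⟩
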